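/- Let $d\ge 1$, let $\theta\in\mathbb{R}$, and let $a,w_1,\dots,w_d$ lie in the open half-plane $\mathcal{H}=\{z:\theta-\frac{\pi}{2}<\arg z<\theta+\frac{\pi}{2}\}$; powers $z^s$, $z\in\mathcal{H}$, are taken with the branch of $\log$ on $\mathcal{H}$ whose imaginary part lies in $(\theta-\frac\pi2,\theta+\frac\pi2)$. Write $\mathbf{w}=(w_1,\dots,w_d)$ and $\mathbf{n}\cdot\mathbf{w}=\sum_i n_iw_i$. Let $\zeta_{\rm B}(\alpha,a|\mathbf{w})$ be the analytic continuation to $\mathbb{C}\setminus\{1,\dots,d\}$ of $\sum_{\mathbf{n}\in\mathbb{N}_0^d}(a+\mathbf{n}\cdot\mathbf{w})^{-\alpha}$, $\Re\alpha>d$. For a function $f$ put $$G[f(c+x)]_{x=\mathbf{w}}=\sum_{J\subseteq\{1,\dots,d\}}(-1)^{d-|J|}f\Big(c+\sum_{i\in J}w_i\Big).$$ Define polynomials $B_n(a|\mathbf{w})$ by $z^de^{az}\prod_{i=1}^d\frac{w_i}{e^{w_iz}-1}=\sum_{n\ge0}B_n(a|\mathbf{w})\frac{z^n}{n!}$, and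 ${}_dS_n(a)$ by ${}_dS_n'(a)=\frac{n!}{(n+d-1)!\prod_i w_i}B_{n+d-1}(a|\mathbf{w})$, ${}_dS_n(0)=0$; ${}_dS_n^{(d)}$ denotes the $d$-th derivative. Let $k$ be an integer with $k>-d$. For $\mathbf{n}\in\mathbb{N}_0^d$ put $$T_{\mathbf{n}}(\alpha)=\frac{1}{(a+\mathbf{n}\cdot\mathbf{w})^{\alpha}}-G\left[\sum_{m=0}^{k+d-1}\frac{{}_dS_m^{(d)}(0)}{m!}\frac{d^m}{dx^m}\frac{(a+\mathbf{n}\cdot\mathbf{w}+x)^{d-\alpha}}{(d-\alpha)\cdots(1-\alpha)}\right]_{x=\mathbf{w}},$$ extended to $\alpha=1,\dots,d$ by its limits there, and $$P(\alpha)=(-1)^d\sum_{m=0}^{k+d-1}\frac{{}_dS_m^{(d)}(0)}{m!}\frac{d^m}{da^m}\frac{a^{d-\alpha}}{(d-\alpha)\cdots(1-\alpha)}.$$ Then every $T_{\mathbf{n}}$ is an entire function, and the series $\sum_{\mathbf{n}\in\mathbb{N}_0^d}T_{\mathbf{n}}(\alpha)$ converges uniformly in $\alpha$ on every compact subset of $\{\alpha\in\mathbb{C}:\Re\alpha>-k\}$.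 Hence its sum is analytic in this half-plane. The continuation $\zeta_{\rm B}$ exists, and $$\zeta_{\rm B}(\alpha,a|\mathbf{w})=\sum_{\mathbf{n}\in\mathbb{N}_0^d}T_{\mathbf{n}}(\alpha)+P(\alpha)\qquad(\Re\alpha>-k,\ \alpha\notin\{1,\dots,d\}).$$ Consequently the pole structure of $\zeta_{\rm B}$ in $\{\Re\alpha>-k\}$ is that of the term $P$ outside the series: both functions are meromorphic there, they have the same poles with the same orders, and their difference extends analytically to the half-plane. -/

import Mathlib

open Filter Topology Complex
open scoped Nat

noncomputable section

namespace Barnes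

/-- The open half-plane `θ - π/2 < arg z < θ + π/2`. -/
def halfPlane (θ : ℝ) : Set ℂ := {z | 0 < (exp (-(θ * I)) * z).re}

/-- The branch of the logarithm on `halfPlane θ` whose imaginary part lies in
`(θ - π/2, θ + π/2)`.  As `θ` ranges over all real numbers (and not just modulo `2π`), this
covers all continuous branches of the logarithm on all half-planes. -/
def branchLog (θ : ℝ) (z : ℂ) : ℂ := log (exp (-(θ * I)) * z) + θ * I

/-- The power `z ^ s` on `halfPlane θ` with respect to the branch `branchLog θ`. -/
def branchPow (θ : ℝ) (z s : ℂ) : ℂ := exp (s * branchLog θ z)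

theorem exp_branchLog (θ : ℝ) {z : ℂ} (hz : z ≠ 0) : exp (branchLog θ z) = z := by
  rw [branchLog, exp_add, exp_log (mul_ne_zero (exp_ne_zero _) hz), mul_right_comm, ← exp_add]
  simp

/-- The lattice point `a + n · w`. -/
def latticePoint {d : ℕ} (a : ℂ) (w : Fin d → ℂ) (n : Fin d → ℕ) : ℂ :=
  a + ∑ i, (n i : ℂ) * w i

/-- The power series of `(e^{cz} - 1) / (cz)`, that is `∑ cʲ zʲ / (j+1)!`. -/
def expQuot (c : ℂ) : PowerSeries ℂ := PowerSeries.mk fun j => c ^ j / ((j + 1)! : ℂ)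

/-- The power series of `∏ᵢ wᵢ z / (e^{wᵢ z} - 1)`. -/
def toddSeries {d : ℕ} (w : Fin d → ℂ) : PowerSeries ℂ := ∏ i, (expQuot (w i))⁻¹

/-- The higher order Bernoulli polynomial `B_n(a | w)`, as a polynomial in `a`. Its generating
function `z^d e^{az} ∏ᵢ wᵢ / (e^{wᵢ z} - 1) = ∑ B_n(a | w) zⁿ / n!` is
`mk_bernoulliPoly_mul` below. -/
def bernoulliPoly {d : ℕ} (w : Fin d → ℂ) (n : ℕ) : Polynomial ℂ :=
  ∑ j ∈ Finset.range (n + 1),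
    Polynomial.monomial j ((n ! : ℂ) / (j ! : ℂ) * PowerSeries.coeff (n - j) (toddSeries w))

/-- Barnes' Bernoullian function `_dS_n(a)`: the primitive, vanishing at `0`, of
`n! / ((n+d-1)! ∏ wᵢ) * B_{n+d-1}(a | w)`. See `derivative_bernoullian`, `bernoullian_zero`. -/
def bernoullian {d : ℕ} (w : Fin d → ℂ) (n : ℕ) : Polynomial ℂ :=
  ∑ j ∈ Finset.range (n + d), Polynomial.monomial (j + 1)
    ((n ! : ℂ) / (((n + d - 1)! : ℂ) * ∏ i, w i) *
      (bernoulliPoly w (n + d - 1)).coeff j / (j + 1))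

theorem X_mul_expQuot (c : ℂ) :
    PowerSeries.C c * PowerSeries.X * expQuot c
      = PowerSeries.rescale c (PowerSeries.exp ℂ) - 1 := by
  ext n
  rw [mul_assoc, PowerSeries.coeff_C_mul]
  cases n with
  | zero =>
    rw [map_sub, PowerSeries.coeff_rescale]
    simp
  | succ n =>
    rw [PowerSeries.coeff_succ_X_mul]
    simp [expQuot, PowerSeries.coeff_one, PowerSeries.coeff_exp, PowerSeries.coeff_rescale]
    ring

theorem mk_bernoulliPoly {d : ℕ} (w : Fin d → ℂ) (a : ℂ) :
    (PowerSeries.mk fun n => (bernoulliPoly w n).eval a / (n ! : ℂ))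
      = PowerSeries.rescale a (PowerSeries.exp ℂ) * toddSeries w := by
  ext n
  rw [PowerSeries.coeff_mk, PowerSeries.coeff_mul,
    Finset.Nat.sum_antidiagonal_eq_sum_range_succ_mk, bernoulliPoly,
    Polynomial.eval_finsetSum, Finset.sum_div]
  refine Finset.sum_congr rfl fun j _ => ?_
  have h : (n ! : ℂ) ≠ 0 := by exact_mod_cast n.factorial_ne_zero
  simp [PowerSeries.coeff_exp, PowerSeries.coeff_rescale]
  field_simp

/-- The generating function of the higher order Bernoulli polynomials. -/
theorem mk_bernoulliPoly_mul {d : ℕ} (w : Fin d → ℂ) (a : ℂ) :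
    (PowerSeries.mk fun n => (bernoulliPoly w n).eval a / (n ! : ℂ)) *
        ∏ i, (PowerSeries.rescale (w i) (PowerSeries.exp ℂ) - 1)
      = PowerSeries.X ^ d * PowerSeries.rescale a (PowerSeries.exp ℂ) *
        ∏ i, PowerSeries.C (w i) := by
  have h : toddSeries w * ∏ i, expQuot (w i) = 1 := by
    rw [toddSeries, ← Finset.prod_mul_distrib]
    refine Finset.prod_eq_one fun i _ => PowerSeries.inv_mul_cancel _ ?_
    simp [expQuot]
  simp_rw [← X_mul_expQuot]
  rw [mk_bernoulliPoly, Finset.prod_mul_distrib, Finset.prod_mul_distrib, Finset.prod_const,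
    Finset.card_univ, Fintype.card_fin]
  linear_combination (PowerSeries.X ^ d * PowerSeries.rescale a (PowerSeries.exp ℂ) *
        ∏ i, PowerSeries.C (w i)) * h

theorem derivative_bernoullian {d : ℕ} (hd : 1 ≤ d) (w : Fin d → ℂ) (n : ℕ) :
    Polynomial.derivative (bernoullian w n)
      = Polynomial.C ((n ! : ℂ) / (((n + d - 1)! : ℂ) * ∏ i, w i)) *
        bernoulliPoly w (n + d - 1) := by
  have hdeg : (bernoulliPoly w (n + d - 1)).natDegree < n + d := by
    refine lt_of_le_of_lt (b := n + d - 1) ?_ (by omega)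
    refine Polynomial.natDegree_sum_le_of_forall_le _ _ fun j hj => ?_
    have := Finset.mem_range.1 hj
    exact (Polynomial.natDegree_monomial_le _).trans (by omega)
  conv_rhs => rw [(bernoulliPoly w (n + d - 1)).as_sum_range' _ hdeg]
  rw [bernoullian, Polynomial.derivative_sum, Finset.mul_sum]
  refine Finset.sum_congr rfl fun j _ => ?_
  rw [Polynomial.derivative_monomial, Polynomial.C_mul_monomial]
  congr 1
  have : (j : ℂ) + 1 ≠ 0 := by exact_mod_cast j.succ_ne_zero
  push_cast
  field_simp

theorem bernoullian_zero {d : ℕ} (w : Fin d → ℂ) (n : ℕ) : (bernoullian w n).eval 0 = 0 := by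
  simp [bernoullian, Polynomial.eval_finsetSum]

/-- The alternating sum `G[f(c + x)]_{x = w}`: the sum over all subsets `J` of the indices of
`(-1)^{d - |J|} f(c + ∑_{i ∈ J} wᵢ)`. -/
def altSum {d : ℕ} (w : Fin d → ℂ) (f : ℂ → ℂ) (c : ℂ) : ℂ :=
  ∑ J : Finset (Fin d), (-1) ^ (d - J.card) * f (c + ∑ i ∈ J, w i)

/-- `∑_{m=0}^{k+d-1} _dS_m^{(d)}(0)/m! * d^m/dx^m [x^{d-α} / ((d-α)⋯(1-α))]` -/
def kernel {d : ℕ} (θ : ℝ) (w : Fin d → ℂ) (k : ℤ) (α x : ℂ) : ℂ :=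
  ∑ m ∈ Finset.range (k + d).toNat,
    (Polynomial.derivative^[d] (bernoullian w m)).eval 0 / (m ! : ℂ) *
      iteratedDeriv m
        (fun y => branchPow θ y (d - α) / ∏ j ∈ Finset.Icc 1 d, ((j : ℂ) - α)) x

/-- The points `1, …, d`. -/
def poles (d : ℕ) : Set ℂ := {α | ∃ q ∈ Finset.Icc 1 d, α = (q : ℂ)}

/-- The `n`-th summand of the series, as a formula in `α` valid off `{1, …, d}`. -/
def rawTerm {d : ℕ} (θ : ℝ) (a : ℂ) (w : Fin d → ℂ) (k : ℤ) (n : Fin d → ℕ) (α : ℂ) : ℂ :=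
  1 / branchPow θ (latticePoint a w n) α - altSum w (kernel θ w k α) (latticePoint a w n)

open Classical in
/-- The `n`-th summand of the series, continued to the points `α = 1, …, d` by its limit. -/
def summand {d : ℕ} (θ : ℝ) (a : ℂ) (w : Fin d → ℂ) (k : ℤ) (n : Fin d → ℕ) (α : ℂ) : ℂ :=
  if α ∈ poles d then limUnder (𝓝[≠] α) (rawTerm θ a w k n) else rawTerm θ a w k n α

/-- The term outside the series (meaningful off `{1, …, d}`). -/
def finiteTerm {d : ℕ} (θ : ℝ) (a : ℂ) (w : Fin d → ℂ) (k : ℤ) (α : ℂ) : ℂ :=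
  (-1) ^ d * kernel θ w k α a

/-- `Z` is an analytic continuation to `ℂ \ {1, …, d}` of the Barnes series
`∑_n (a + n · w)^{-α}`, `Re α > d`. -/
def IsZetaContinuation {d : ℕ} (θ : ℝ) (a : ℂ) (w : Fin d → ℂ) (Z : ℂ → ℂ) : Prop :=
  DifferentiableOn ℂ Z (poles d)ᶜ ∧
    ∀ α : ℂ, (d : ℝ) < α.re →
      HasSum (fun n : Fin d → ℕ => branchPow θ (latticePoint a w n) (-α)) (Z α)

open Classical in
/-- The Barnes zeta function `ζ_B(α, a | w)`: the analytic continuation of the Barnes series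
(unique on `ℂ \ {1, …, d}`, which is connected). -/
def zeta {d : ℕ} (θ : ℝ) (a : ℂ) (w : Fin d → ℂ) : ℂ → ℂ :=
  if h : ∃ Z, IsZetaContinuation θ a w Z then h.choose else 0

end Barnes

end

/-! Let D = d/dx. Formally G is the operator ∏ (e^{wᵢD} - 1), and the numbers `_dS_m^{(d)}(0)/m!`
are the coefficients of the inverse series of ∏ (e^{wᵢD} - 1) / D^d. With N = k + d terms of that
series, G composed with the truncated operator is D^d up to terms of order D^{d+N}
(`sum_toddCoeff_mul`). The function x^{d-α}/((d-α)⋯(1-α)) has d-th derivative x^{-α}, so each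
summand of the series is a combination of Taylor remainders of order d + N. The derivative of that
order is ∏_{i<N} (-α-i) · x^{-α-N}: the denominators have cancelled. Hence the summand is
O(depth^{-(Re α + N)}), with a constant that does not blow up at 1, …, d
(`norm_sub_altSum_kernel_le`).

This one bound gives both removability of the singularities (`differentiable_summand`) and, since Re
α + k + d > d, locally uniform convergence over the d-dimensional lattice.

For Re α > d the G-terms telescope over boxes (`sum_altSum_box`); as the box grows, only the corner
a survives and contributes P(α) (`tendsto_sum_box_altSum_kernel`). So the Barnes series equals the
regularised series plus P. The identity theorem makes these formulas agree for different k and glues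
them into the continuation. Adding an analytic function to P leaves its pole orders unchanged. -/

namespace Barnes

/-! ### Algebra of the alternating sum and the Todd operator -/

theorem altSum_prod {R : Type*} [CommRing R] {d : ℕ} (u : Fin d → R) :
    ∏ i, (u i - 1) = ∑ J : Finset (Fin d), (-1) ^ (d - J.card) * ∏ i ∈ J, u i := by
  simp_rw [sub_eq_add_neg]
  rw [Fintype.prod_add]
  refine Finset.sum_congr rfl fun J _ => ?_
  rw [Finset.prod_const, Finset.card_compl, Fintype.card_fin, mul_comm]

theorem prod_rescale_exp {ι : Type*} (s : Finset ι) (w : ι → ℂ) :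
    ∏ i ∈ s, PowerSeries.rescale (w i) (PowerSeries.exp ℂ)
      = PowerSeries.rescale (∑ i ∈ s, w i) (PowerSeries.exp ℂ) := by
  classical
  induction s using Finset.induction_on with
  | empty => ext n; cases n <;> simp [PowerSeries.coeff_one]
  | insert i s hi ih =>
    rw [Finset.prod_insert hi, Finset.sum_insert hi, ih, PowerSeries.exp_mul_exp_eq_exp_add]

theorem altSum_pow_div_factorial {d : ℕ} (w : Fin d → ℂ) (j : ℕ) :
    ∑ J : Finset (Fin d), (-1) ^ (d - J.card) * ((∑ i ∈ J, w i) ^ j / (j ! : ℂ))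
      = PowerSeries.coeff j (∏ i, (PowerSeries.rescale (w i) (PowerSeries.exp ℂ) - 1)) := by
  rw [altSum_prod, map_sum]
  refine Finset.sum_congr rfl fun J _ => ?_
  have h : ((-1) ^ (d - J.card) : PowerSeries ℂ) = PowerSeries.C ((-1) ^ (d - J.card)) := by simp
  rw [prod_rescale_exp, h, PowerSeries.coeff_C_mul, PowerSeries.coeff_rescale,
    PowerSeries.coeff_exp]
  simp [div_eq_mul_inv]

/-- Exhibits the zero of order d at the origin, which is why G annihilates polynomials of degree
below d. -/
theorem prod_rescale_exp_sub_one {d : ℕ} (w : Fin d → ℂ) :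
    ∏ i, (PowerSeries.rescale (w i) (PowerSeries.exp ℂ) - 1)
      = PowerSeries.X ^ d * (PowerSeries.C (∏ i, w i) * ∏ i, expQuot (w i)) := by
  simp_rw [← X_mul_expQuot]
  rw [Finset.prod_mul_distrib, Finset.prod_mul_distrib, Finset.prod_const,
    Finset.card_univ, Fintype.card_fin, map_prod]
  ring

/-- The coefficient `_dS_m^{(d)}(0) / m!` of the operator in `kernel`. -/
noncomputable def toddCoeff {d : ℕ} (w : Fin d → ℂ) (m : ℕ) : ℂ :=
  PowerSeries.coeff m (toddSeries w) / ∏ i, w i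

theorem toddSeries_mul_prod_expQuot {d : ℕ} (w : Fin d → ℂ) :
    toddSeries w * ∏ i, expQuot (w i) = 1 := by
  rw [toddSeries, ← Finset.prod_mul_distrib]
  refine Finset.prod_eq_one fun i _ => PowerSeries.inv_mul_cancel _ ?_
  simp [expQuot]

theorem eval_zero_iterate_derivative_bernoullian {d : ℕ} (hd : 1 ≤ d) (w : Fin d → ℂ) (m : ℕ) :
    (Polynomial.derivative^[d] (bernoullian w m)).eval 0 / (m ! : ℂ) = toddCoeff w m := by
  obtain ⟨e, rfl⟩ : ∃ e, d = e + 1 := ⟨d - 1, by omega⟩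
  rw [← Polynomial.coeff_zero_eq_eval_zero, Polynomial.coeff_iterate_derivative, zero_add,
    Nat.descFactorial_self]
  have h1 : (bernoulliPoly w (m + (e + 1) - 1)).coeff e
      = (((m + e)! : ℂ) / (e ! : ℂ)) * PowerSeries.coeff m (toddSeries w) := by
    rw [bernoulliPoly, Polynomial.finsetSum_coeff]
    simp_rw [Polynomial.coeff_monomial]
    rw [Finset.sum_ite_eq' , if_pos (Finset.mem_range.2 (by omega))]
    simp [show m + (e + 1) - 1 = m + e by omega]
  have h2 : (bernoullian w m).coeff (e + 1)
      = (m ! : ℂ) / (((m + e)! : ℂ) * ∏ i, w i) *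
      (((m + e)! : ℂ) / (e ! : ℂ) * PowerSeries.coeff m (toddSeries w)) / (e + 1) := by
    rw [bernoullian, Polynomial.finsetSum_coeff]
    simp_rw [Polynomial.coeff_monomial, add_left_inj]
    rw [Finset.sum_ite_eq', if_pos (Finset.mem_range.2 (by omega)), h1]
    simp [show m + (e + 1) - 1 = m + e by omega]
  have h3 : ((m + e)! : ℂ) ≠ 0 := by exact_mod_cast Nat.factorial_ne_zero _
  have h4 : (m ! : ℂ) ≠ 0 := by exact_mod_cast Nat.factorial_ne_zero _
  have h5 : (e ! : ℂ) ≠ 0 := by exact_mod_cast Nat.factorial_ne_zero _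
  have h6 : (e + 1 : ℂ) ≠ 0 := by exact_mod_cast e.succ_ne_zero
  rw [h2, toddCoeff, Nat.factorial_succ]
  simp only [nsmul_eq_mul]
  push_cast
  -- If some wᵢ vanishes, both sides are 0 because division by zero is 0.
  by_cases hP : ∏ i, w i = 0
  · simp [hP]
  · field_simp

/-- The truncated Todd operator inverts the alternating sum up to order `d`. -/
theorem sum_toddCoeff_mul {d : ℕ} {w : Fin d → ℂ} (hw : ∀ i, w i ≠ 0) {N : ℕ} (hN : 0 < N)
    (F : ℕ → ℂ) :
    ∑ m ∈ Finset.range N, toddCoeff w m * ∑ J : Finset (Fin d), (-1) ^ (d - J.card) *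
      ∑ j ∈ Finset.range (d + N - m), (∑ i ∈ J, w i) ^ j / (j ! : ℂ) * F (m + j) = F d := by
  have hP : ∏ i, w i ≠ 0 := Finset.prod_ne_zero_iff.2 fun i _ => hw i
  set q := ∏ i, (PowerSeries.rescale (w i) (PowerSeries.exp ℂ) - 1) with hq
  have hq0 : ∀ j < d, PowerSeries.coeff j q = 0 := fun j hj => by
    rw [hq, prod_rescale_exp_sub_one, PowerSeries.coeff_X_pow_mul', if_neg (by omega)]
  have h1 : ∀ m, ∑ J : Finset (Fin d), (-1 : ℂ) ^ (d - J.card) *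
      ∑ j ∈ Finset.range (d + N - m), (∑ i ∈ J, w i) ^ j / (j ! : ℂ) * F (m + j)
      = ∑ j ∈ Finset.range (d + N - m), PowerSeries.coeff j q * F (m + j) := fun m => by
    simp_rw [Finset.mul_sum]
    rw [Finset.sum_comm]
    refine Finset.sum_congr rfl fun j _ => ?_
    rw [hq, ← altSum_pow_div_factorial, Finset.sum_mul]
    exact Finset.sum_congr rfl fun J _ => by ring
  simp_rw [h1]
  -- The added indices m ≥ N force j < d, where the coefficients of q vanish. The index set becomes
  -- a full triangle, which can be summed along the diagonals m + j = l.
  have h2 : ∑ m ∈ Finset.range N, toddCoeff w m *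
        ∑ j ∈ Finset.range (d + N - m), PowerSeries.coeff j q * F (m + j)
      = ∑ m ∈ Finset.range (d + N),
        ∑ j ∈ Finset.range (d + N - m), toddCoeff w m * (PowerSeries.coeff j q * F (m + j)) := by
    simp_rw [← Finset.mul_sum]
    refine Finset.sum_subset (Finset.range_subset_range.2 (by omega)) fun m _ hm => ?_
    rw [Finset.sum_eq_zero, mul_zero]
    intro j hj
    rw [Finset.mem_range] at hj hm
    rw [hq0 j (by omega), zero_mul]
  rw [h2, ← Finset.sum_range_diag_flip (d + N)
    fun m j => toddCoeff w m * (PowerSeries.coeff j q * F (m + j))]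
  -- The diagonal sums are the coefficients of this product, so only l = d contributes.
  have h3 : PowerSeries.C (∏ i, w i)⁻¹ * toddSeries w * q = PowerSeries.X ^ d := by
    rw [hq, prod_rescale_exp_sub_one]
    have h4 : PowerSeries.C (∏ i, w i)⁻¹ * PowerSeries.C (∏ i, w i) = 1 := by
      rw [← map_mul, inv_mul_cancel₀ hP, map_one]
    linear_combination (PowerSeries.X ^ d * toddSeries w * ∏ i, expQuot (w i)) * h4 +
      PowerSeries.X ^ d * toddSeries_mul_prod_expQuot w
  have h5 : ∀ l, ∑ m ∈ Finset.range (l + 1),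
      toddCoeff w m * (PowerSeries.coeff (l - m) q * F (m + (l - m)))
      = if l = d then F d else 0 := fun l => by
    have := congrArg (PowerSeries.coeff l) h3
    rw [mul_assoc, PowerSeries.coeff_C_mul, PowerSeries.coeff_mul,
      Finset.Nat.sum_antidiagonal_eq_sum_range_succ_mk, PowerSeries.coeff_X_pow] at this
    trans F l * (if l = d then 1 else 0)
    · rw [← this, Finset.mul_sum, Finset.mul_sum]
      refine Finset.sum_congr rfl fun m hm => ?_
      rw [Finset.mem_range] at hm
      rw [toddCoeff, show m + (l - m) = l by omega]
      ring
    · split_ifs with h <;> simp [h]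
  simp_rw [h5]
  rw [Finset.sum_ite_eq', if_pos (Finset.mem_range.2 (by omega))]

/-- Telescoping in d variables, done in the group algebra of (ℂ, +). There `s x` is the formal
translation by x, G is ∏ (s(wᵢ) - 1), and the sum over the box factors into geometric sums, each
satisfying (∑_{m<M} sᵐ)(s - 1) = s^M - 1. The linear map `Λ` turns the formal identity into one
about f. -/
theorem sum_altSum_box {d : ℕ} (w : Fin d → ℂ) (f : ℂ → ℂ) (a : ℂ) (M : ℕ) :
    ∑ n ∈ Fintype.piFinset fun _ : Fin d => Finset.range M, altSum w f (latticePoint a w n)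
      = altSum (fun i => M * w i) f a := by
  let s : ℂ → AddMonoidAlgebra ℂ ℂ := fun x => AddMonoidAlgebra.single x 1
  let Λ : AddMonoidAlgebra ℂ ℂ →ₗ[ℂ] ℂ := Finsupp.linearCombination ℂ (fun x => f (a + x)) ∘ₗ
    (AddMonoidAlgebra.coeffLinearEquiv ℂ).toLinearMap
  have hs : ∀ x y, s (x + y) = s x * s y := fun x y => by
    simp [s, AddMonoidAlgebra.single_mul_single]
  have hsum : ∀ (J : Finset (Fin d)) (v : Fin d → ℂ), ∏ i ∈ J, s (v i) = s (∑ i ∈ J, v i) := by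
    intro J v
    induction J using Finset.induction_on with
    | empty => simp [s, AddMonoidAlgebra.one_def]
    | insert i J hi ih => rw [Finset.prod_insert hi, Finset.sum_insert hi, ih, hs]
  have hΛ : ∀ x, Λ (s x) = f (a + x) := fun x => by simp [Λ, s]
  have hsign : ∀ (k : ℕ) x, Λ ((-1) ^ k * x) = (-1) ^ k * Λ x := fun k x => by
    rcases Nat.even_or_odd k with hk | hk <;> simp [hk.neg_one_pow]
  have key : ∀ (v : Fin d → ℂ) (y : ℂ), Λ (s y * ∏ i, (s (v i) - 1)) = altSum v f (a + y) := by
    intro v y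
    rw [altSum_prod, Finset.mul_sum, map_sum, altSum]
    refine Finset.sum_congr rfl fun J _ => ?_
    rw [mul_left_comm, hsign, hsum, ← hs, hΛ, add_assoc]
  have hpow : ∀ (m : ℕ) x, s (m * x) = s x ^ m := fun m x => by
    simp [s, AddMonoidAlgebra.single_pow]
  have hone : s 0 = 1 := rfl
  have hbox : ∀ n : Fin d → ℕ, altSum w f (latticePoint a w n)
      = Λ ((∏ i, s (w i) ^ n i) * ∏ i, (s (w i) - 1)) := fun n => by
    simp_rw [latticePoint, ← key, ← hpow]
    rw [hsum]
  simp_rw [hbox]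
  rw [← map_sum, ← Finset.sum_mul,
    ← Finset.prod_univ_sum (fun _ : Fin d => Finset.range M) fun i m => s (w i) ^ m,
    ← Finset.prod_mul_distrib]
  simp_rw [geom_sum_mul, ← hpow]
  rw [← one_mul (∏ i, (s (M * w i) - 1)), ← add_zero a, ← key, hone]

end Barnes

/-! ### Complex powers on the half-plane and Taylor remainders -/

noncomputable section

namespace Barnes

/-- The distance of `z` from the boundary line of `halfPlane θ`, with sign. -/
def depth (θ : ℝ) (z : ℂ) : ℝ := (exp (-(θ * I)) * z).re

theorem depth_add (θ : ℝ) (x y : ℂ) : depth θ (x + y) = depth θ x + depth θ y := by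
  simp [depth, mul_add]

theorem depth_real_mul (θ t : ℝ) (x : ℂ) : depth θ (t * x) = t * depth θ x := by
  rw [depth, depth, mul_left_comm, re_ofReal_mul]

theorem depth_sum {ι : Type*} (θ : ℝ) (s : Finset ι) (f : ι → ℂ) :
    depth θ (∑ i ∈ s, f i) = ∑ i ∈ s, depth θ (f i) := by
  simp [depth, Finset.mul_sum]

theorem depth_latticePoint {d : ℕ} (θ : ℝ) (a : ℂ) (w : Fin d → ℂ) (n : Fin d → ℕ) :
    depth θ (latticePoint a w n) = depth θ a + ∑ i, n i * depth θ (w i) := by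
  rw [latticePoint, depth_add, depth_sum]
  congr 1
  refine Finset.sum_congr rfl fun i _ => ?_
  rw [← ofReal_natCast, depth_real_mul]

theorem depth_sum_nonneg {d : ℕ} {θ : ℝ} {w : Fin d → ℂ} (hw : ∀ i, w i ∈ halfPlane θ)
    (J : Finset (Fin d)) : 0 ≤ depth θ (∑ i ∈ J, w i) := by
  rw [depth_sum]
  exact Finset.sum_nonneg fun i _ => (hw i).le

theorem isOpen_halfPlane (θ : ℝ) : IsOpen (halfPlane θ) :=
  isOpen_lt continuous_const (by fun_prop)

theorem ne_zero_of_mem_halfPlane {θ : ℝ} {z : ℂ} (hz : z ∈ halfPlane θ) : z ≠ 0 := by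
  rintro rfl
  simp [halfPlane] at hz

theorem latticePoint_mem_halfPlane {d : ℕ} {θ : ℝ} {a : ℂ} {w : Fin d → ℂ}
    (ha : a ∈ halfPlane θ) (hw : ∀ i, w i ∈ halfPlane θ) (n : Fin d → ℕ) :
    latticePoint a w n ∈ halfPlane θ := by
  change 0 < depth θ _
  rw [depth_latticePoint]
  exact add_pos_of_pos_of_nonneg ha
    (Finset.sum_nonneg fun i _ => mul_nonneg (Nat.cast_nonneg _) (hw i).le)

theorem add_sum_mem_halfPlane {d : ℕ} {θ : ℝ} {x : ℂ} {w : Fin d → ℂ}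
    (hx : x ∈ halfPlane θ) (hw : ∀ i, w i ∈ halfPlane θ) (J : Finset (Fin d)) :
    x + ∑ i ∈ J, w i ∈ halfPlane θ := by
  change 0 < depth θ _
  rw [depth_add]
  exact add_pos_of_pos_of_nonneg hx (depth_sum_nonneg hw J)

theorem hasDerivAt_branchPow {θ : ℝ} {z : ℂ} (hz : z ∈ halfPlane θ) (s : ℂ) :
    HasDerivAt (fun y => branchPow θ y s) (s * branchPow θ z (s - 1)) z := by
  have h0 := ne_zero_of_mem_halfPlane hz
  have h1 : HasDerivAt (branchLog θ) z⁻¹ z := by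
    have := (((hasDerivAt_id z).const_mul (exp (-(θ * I)))).clog (Or.inl hz)).add_const (θ * I)
    refine this.congr_deriv ?_
    have := exp_ne_zero (-(θ * I))
    simp only [id]
    field_simp
  refine (h1.const_mul s).cexp.congr_deriv ?_
  rw [branchPow, sub_mul, exp_sub, one_mul, exp_branchLog θ h0]
  field_simp

/-- The modulus of z^s is |z|^{Re s} e^{-Im s · Im log z}. The imaginary part of the logarithm is at
most |θ| + π in absolute value, and |z| may be replaced by the smaller depth because the exponent is
nonpositive. Unlike |z|, depth is additive along the lattice. -/
theorem norm_branchPow_le {θ : ℝ} {z : ℂ} (hz : z ∈ halfPlane θ) {s : ℂ} (hs : s.re ≤ 0) :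
    ‖branchPow θ z s‖ ≤ Real.exp (‖s‖ * (|θ| + Real.pi)) * depth θ z ^ s.re := by
  have hpos : 0 < depth θ z := hz
  rw [branchPow, norm_exp, Real.rpow_def_of_pos hpos, ← Real.exp_add, Real.exp_le_exp, branchLog,
    mul_re]
  simp only [add_re, add_im, log_re, log_im, mul_re, mul_im, I_re, I_im, ofReal_re, ofReal_im]
  have h1 : Real.log (depth θ z) ≤ Real.log ‖exp (-(θ * I)) * z‖ :=
    Real.log_le_log hpos (re_le_norm _)
  have h2 : |arg (exp (-(θ * I)) * z) + θ| ≤ |θ| + Real.pi := by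
    refine (abs_add_le _ _).trans ?_
    linarith [abs_arg_le_pi (exp (-(θ * I)) * z)]
  have h3 : |s.im * (arg (exp (-(θ * I)) * z) + θ)| ≤ ‖s‖ * (|θ| + Real.pi) := by
    rw [abs_mul]
    exact mul_le_mul (abs_im_le_norm s) h2 (abs_nonneg _) (norm_nonneg _)
  have h4 := neg_abs_le (s.im * (arg (exp (-(θ * I)) * z) + θ))
  have h5 := mul_le_mul_of_nonpos_left h1 hs
  simp only [mul_zero, mul_one, sub_zero, add_zero]
  linarith [mul_comm s.re (Real.log (depth θ z))]

/-- The `l`-th derivative of `x^{d-α} / ((d-α)⋯(1-α))`. -/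
def powDeriv (θ : ℝ) (d : ℕ) (α : ℂ) (l : ℕ) (x : ℂ) : ℂ :=
  (∏ i ∈ Finset.range l, ((d : ℂ) - α - i)) / (∏ j ∈ Finset.Icc 1 d, ((j : ℂ) - α)) *
    branchPow θ x (d - α - l)

theorem hasDerivAt_powDeriv {θ : ℝ} {x : ℂ} (hx : x ∈ halfPlane θ) (d : ℕ) (α : ℂ) (l : ℕ) :
    HasDerivAt (powDeriv θ d α l) (powDeriv θ d α (l + 1) x) x := by
  refine ((hasDerivAt_branchPow hx (d - α - l)).const_mul _).congr_deriv ?_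
  rw [powDeriv, Finset.prod_range_succ]
  push_cast
  rw [← sub_sub]
  ring

theorem iteratedDeriv_eq_powDeriv {θ : ℝ} (d : ℕ) (α : ℂ) (m : ℕ) {x : ℂ}
    (hx : x ∈ halfPlane θ) :
    iteratedDeriv m
      (fun y => branchPow θ y (d - α) / ∏ j ∈ Finset.Icc 1 d, ((j : ℂ) - α)) x
      = powDeriv θ d α m x := by
  induction m generalizing x with
  | zero => simp [powDeriv, div_eq_mul_inv, mul_comm]
  | succ m ih =>
    rw [iteratedDeriv_succ]
    refine HasDerivAt.deriv ((hasDerivAt_powDeriv hx d α m).congr_of_eventuallyEq ?_)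
    filter_upwards [(isOpen_halfPlane θ).mem_nhds hx] with y hy using ih hy

theorem kernel_eq {d : ℕ} (hd : 1 ≤ d) {θ : ℝ} (w : Fin d → ℂ) (k : ℤ) (α : ℂ) {x : ℂ}
    (hx : x ∈ halfPlane θ) :
    kernel θ w k α x
      = ∑ m ∈ Finset.range (k + d).toNat, toddCoeff w m * powDeriv θ d α m x :=
  Finset.sum_congr rfl fun m _ => by
    rw [eval_zero_iterate_derivative_bernoullian hd, iteratedDeriv_eq_powDeriv d α m hx]

theorem prod_Icc_sub_ne_zero {d : ℕ} {α : ℂ} (hα : α ∉ poles d) :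
    ∏ j ∈ Finset.Icc 1 d, ((j : ℂ) - α) ≠ 0 :=
  Finset.prod_ne_zero_iff.2 fun j hj h => hα ⟨j, hj, (sub_eq_zero.1 h).symm⟩

theorem prod_range_sub_eq (d : ℕ) (α : ℂ) :
    ∏ i ∈ Finset.range d, ((d : ℂ) - α - i) = ∏ j ∈ Finset.Icc 1 d, ((j : ℂ) - α) := by
  rw [← Finset.prod_range_reflect, Finset.range_eq_Ico, ← Finset.Ico_add_one_right_eq_Icc,
    Finset.prod_Ico_eq_prod_range, Finset.prod_Ico_eq_prod_range]
  refine Finset.prod_congr (by simp) fun i hi => ?_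
  have : i < d := by simpa using hi
  have h : (d : ℂ) = (d - 1 - (0 + i) : ℕ) + 1 + i := by
    have : d = (d - 1 - (0 + i)) + 1 + i := by omega
    exact_mod_cast this
  rw [h]
  push_cast
  simp
  ring

/-- The first d factors produced by differentiation are exactly the denominator (d-α)⋯(1-α). From
order d on, the derivatives have no singularity in α, which is what makes the later bounds uniform
near 1, …, d. -/
theorem powDeriv_add {θ : ℝ} {d : ℕ} {α : ℂ} (hα : α ∉ poles d) (N : ℕ) (x : ℂ) :
    powDeriv θ d α (d + N) x = (∏ i ∈ Finset.range N, (-α - i)) * branchPow θ x (-α - N) := by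
  rw [powDeriv, Finset.prod_range_add, prod_range_sub_eq,
    mul_div_cancel_left₀ _ (prod_Icc_sub_ne_zero hα)]
  push_cast
  congr 1
  · exact Finset.prod_congr rfl fun i _ => by ring
  · congr 1
    ring

theorem norm_powDeriv_add_le {θ : ℝ} {d : ℕ} {α : ℂ} (hα : α ∉ poles d) {N : ℕ} {R : ℝ}
    (hR : ‖α‖ ≤ R) (hN : -(N : ℝ) ≤ α.re) {x y : ℂ} (hx : x ∈ halfPlane θ)
    (hxy : depth θ x ≤ depth θ y) :
    ‖powDeriv θ d α (d + N) y‖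
      ≤ (R + N) ^ N * Real.exp ((R + N) * (|θ| + Real.pi)) * depth θ x ^ (-(α.re + N)) := by
  have hx' : 0 < depth θ x := hx
  have hy : y ∈ halfPlane θ := hx'.trans_le hxy
  have hR0 : 0 ≤ R := (norm_nonneg _).trans hR
  have hre : (-α - N).re = -(α.re + N) := by simp; ring
  rw [powDeriv_add hα, norm_mul, mul_assoc]
  refine mul_le_mul ?_ ?_ (norm_nonneg _) (by positivity)
  · rw [norm_prod]
    refine (Finset.prod_le_prod (g := fun _ => R + N) (fun i _ => norm_nonneg _)
      fun i hi => ?_).trans (by simp)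
    have : (i : ℝ) ≤ N := by exact_mod_cast (Finset.mem_range.1 hi).le
    refine (norm_sub_le _ _).trans ?_
    rw [norm_neg, Complex.norm_natCast]
    linarith
  · refine (norm_branchPow_le hy (by rw [hre]; linarith)).trans ?_
    rw [hre]
    refine mul_le_mul ?_ ?_ (Real.rpow_nonneg (hx'.trans_le hxy).le _) (by positivity)
    · refine Real.exp_le_exp.2 (mul_le_mul_of_nonneg_right ?_ (by positivity))
      refine (norm_sub_le _ _).trans ?_
      rw [norm_neg, Complex.norm_natCast]
      linarith
    · exact Real.rpow_le_rpow_of_nonpos hx' hxy (by linarith)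

/-- Taylor's theorem along a segment, for a sequence of successive derivatives. -/
theorem norm_sub_taylor_le {F : ℕ → ℂ → ℂ} {x h : ℂ} {B : ℝ} (M : ℕ)
    (hF : ∀ l, ∀ t ∈ Set.Icc (0 : ℝ) 1, HasDerivAt (F l) (F (l + 1) (x + t * h)) (x + t * h))
    (hB : ∀ t ∈ Set.Icc (0 : ℝ) 1, ‖F M (x + t * h)‖ ≤ B) :
    ‖F 0 (x + h) - ∑ j ∈ Finset.range M, h ^ j / (j ! : ℂ) * F j x‖ ≤ ‖h‖ ^ M * B := by
  have hB0 : 0 ≤ B := (norm_nonneg _).trans (hB 0 (by simp))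
  -- The induction needs the bound on the whole segment: the t-derivative of the remainder is h
  -- times the lower-order remainder of the shifted sequence, and the mean value inequality
  -- integrates it. No factor 1/M! is sought.
  suffices H : ∀ t ∈ Set.Icc (0 : ℝ) 1,
      ‖F 0 (x + t * h) - ∑ j ∈ Finset.range M, (t * h) ^ j / (j ! : ℂ) * F j x‖ ≤ ‖h‖ ^ M * B by
    simpa using H 1 (by simp)
  induction M generalizing F with
  | zero => simpa using hB
  | succ M ih =>
    have ih' := ih (F := fun l => F (l + 1)) (fun l => hF (l + 1)) hB
    intro t ht
    let g : ℝ → ℂ := fun t =>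
      F 0 (x + t * h) - ∑ j ∈ Finset.range (M + 1), (t * h) ^ j / (j ! : ℂ) * F j x
    let g' : ℝ → ℂ := fun t => h * (F 1 (x + t * h)
      - ∑ j ∈ Finset.range M, (t * h) ^ j / (j ! : ℂ) * F (j + 1) x)
    have hg : ∀ s ∈ Set.Icc (0 : ℝ) 1, HasDerivWithinAt g (g' s) (Set.Icc 0 1) s := by
      intro s hs
      have e1 : HasDerivAt (fun t : ℝ => (t : ℂ) * h) h s := by
        simpa using (hasDerivAt_id s).ofReal_comp.mul_const h
      have e2 : HasDerivAt (fun t : ℝ => F 0 (x + t * h)) (F 1 (x + s * h) * h) s :=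
        (hF 0 s hs).comp s (e1.const_add x)
      have e3 : HasDerivAt (fun t : ℝ => ∑ j ∈ Finset.range (M + 1),
          (t * h) ^ j / (j ! : ℂ) * F j x)
          (∑ j ∈ Finset.range (M + 1), (j * (s * h) ^ (j - 1) * h) / (j ! : ℂ) * F j x) s :=
        HasDerivAt.fun_sum fun j _ => ((e1.pow j).div_const _).mul_const _
      refine HasDerivAt.hasDerivWithinAt ?_
      refine (e2.sub e3).congr_deriv ?_
      rw [Finset.sum_range_succ']
      simp only [g', mul_sub, Finset.mul_sum, CharP.cast_eq_zero, zero_mul, zero_div, add_zero]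
      congr 1
      · ring
      · refine Finset.sum_congr rfl fun j _ => ?_
        have h1 : (j ! : ℂ) ≠ 0 := by exact_mod_cast j.factorial_ne_zero
        have h2 : (j + 1 : ℂ) ≠ 0 := by exact_mod_cast j.succ_ne_zero
        rw [Nat.factorial_succ]
        push_cast
        field_simp
    have hb : ∀ s ∈ Set.Icc (0 : ℝ) 1, ‖g' s‖ ≤ ‖h‖ ^ (M + 1) * B := fun s hs => by
      rw [norm_mul, pow_succ', mul_assoc]
      exact mul_le_mul_of_nonneg_left (ih' s hs) (norm_nonneg _)
    have hg_zero : g 0 = 0 := by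
      simp [g, Finset.sum_range_succ']
    have := (convex_Icc (0 : ℝ) 1).norm_image_sub_le_of_norm_hasDerivWithin_le hg hb
      (Set.left_mem_Icc.2 zero_le_one) ht
    rw [hg_zero, sub_zero, sub_zero, Real.norm_of_nonneg ht.1] at this
    exact this.trans (mul_le_of_le_one_right (by positivity) ht.2)

theorem one_div_branchPow (θ : ℝ) (x s : ℂ) : 1 / branchPow θ x s = branchPow θ x (-s) := by
  rw [branchPow, branchPow, neg_mul, exp_neg, one_div]

/-- The summand decays like the power `-α - N` of the depth of the lattice point, uniformly near
the points `1, …, d`. -/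
theorem norm_sub_altSum_kernel_le {d : ℕ} (hd : 1 ≤ d) {θ : ℝ} {w : Fin d → ℂ}
    (hw : ∀ i, w i ∈ halfPlane θ) {k : ℤ} {N : ℕ} (hN : 0 < N) (hkN : (k + d).toNat = N)
    {R : ℝ} (hR0 : 0 ≤ R) :
    ∃ C, 0 ≤ C ∧ ∀ α, α ∉ poles d → ‖α‖ ≤ R → -(N : ℝ) ≤ α.re → ∀ x ∈ halfPlane θ,
      ‖1 / branchPow θ x α - altSum w (kernel θ w k α) x‖ ≤ C * depth θ x ^ (-(α.re + N)) := by
  set A := (R + N) ^ N * Real.exp ((R + N) * (|θ| + Real.pi)) with hA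
  have hA0 : 0 ≤ A := by positivity
  refine ⟨(∑ m ∈ Finset.range N, ‖toddCoeff w m‖ * ∑ J : Finset (Fin d),
    ‖∑ i ∈ J, w i‖ ^ (d + N - m)) * A, by positivity, fun α hα hαR hαN x hx => ?_⟩
  have hw0 : ∀ i, w i ≠ 0 := fun i => ne_zero_of_mem_halfPlane (hw i)
  have hd0 : 1 / branchPow θ x α = powDeriv θ d α d x := by
    rw [one_div_branchPow]
    simpa using (powDeriv_add (θ := θ) hα 0 x).symm
  have hK : altSum w (kernel θ w k α) x = ∑ m ∈ Finset.range N, toddCoeff w m *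
      ∑ J : Finset (Fin d), (-1) ^ (d - J.card) * powDeriv θ d α m (x + ∑ i ∈ J, w i) := by
    rw [altSum]
    simp_rw [Finset.mul_sum]
    rw [Finset.sum_comm]
    refine Finset.sum_congr rfl fun J _ => ?_
    rw [kernel_eq hd w k α (add_sum_mem_halfPlane hx hw J), hkN, Finset.mul_sum]
    exact Finset.sum_congr rfl fun m _ => by ring
  -- Writing x^{-α} as the same double sum with Taylor polynomials in place of function values turns
  -- the difference into a sum of Taylor remainders.
  rw [hd0, ← sum_toddCoeff_mul hw0 hN fun l => powDeriv θ d α l x, hK, ← Finset.sum_sub_distrib,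
    mul_assoc, Finset.sum_mul]
  refine (norm_sum_le _ _).trans (Finset.sum_le_sum fun m hm => ?_)
  rw [← mul_sub, norm_mul, ← Finset.sum_sub_distrib, mul_assoc, Finset.sum_mul]
  refine mul_le_mul_of_nonneg_left ((norm_sum_le _ _).trans
    (Finset.sum_le_sum fun J _ => ?_)) (norm_nonneg _)
  rw [← mul_sub, norm_mul, norm_pow, norm_neg, norm_one, one_pow, one_mul, norm_sub_rev]
  have hseg : ∀ t ∈ Set.Icc (0 : ℝ) 1, depth θ x ≤ depth θ (x + t * ∑ i ∈ J, w i) := by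
    intro t ht
    rw [depth_add, depth_real_mul]
    exact le_add_of_nonneg_right (mul_nonneg ht.1 (depth_sum_nonneg hw J))
  -- The m-th term is expanded to length d + N - m, so every remainder involves the same derivative
  -- order d + N.
  refine norm_sub_taylor_le (F := fun j => powDeriv θ d α (m + j)) (d + N - m)
    (fun l t ht => hasDerivAt_powDeriv (lt_of_lt_of_le hx (hseg t ht)) d α (m + l)) fun t ht => ?_
  rw [show m + (d + N - m) = d + N by have := Finset.mem_range.1 hm; omega]
  exact norm_powDeriv_add_le hα hαR hαN hx (hseg t ht)

end Barnes

end

/-! ### Summability over the lattice -/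

noncomputable section

namespace Barnes

/-- Splitting the power into d equal factors and using 1 + nᵢ ≤ 1 + ∑ n bounds the term by ∏ (1 +
nᵢ)^{-t/d}, a product of convergent one-variable series since t/d > 1. -/
theorem summable_one_add_sum_rpow {d : ℕ} (hd : 1 ≤ d) {t : ℝ} (ht : (d : ℝ) < t) :
    Summable fun n : Fin d → ℕ => (1 + ∑ i, (n i : ℝ)) ^ (-t) := by
  have hd0 : (0 : ℝ) < d := by exact_mod_cast hd
  set f : ℕ → ℝ := fun m => (1 + (m : ℝ)) ^ (-(t / d)) with hf
  have hf0 : ∀ m, 0 ≤ f m := fun m => by positivity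
  have hfs : Summable f := by
    have h : 1 < t / d := (one_lt_div hd0).2 ht
    have := (summable_nat_add_iff 1).2 (Real.summable_nat_rpow.2 (by linarith : -(t / d) < -1))
    refine this.congr fun m => ?_
    rw [hf]
    push_cast
    rw [add_comm]
  refine summable_of_sum_le (c := (∑' m, f m) ^ d) (fun n => by positivity) fun u => ?_
  have h1 : ∀ n : Fin d → ℕ, (1 + ∑ i, (n i : ℝ)) ^ (-t) ≤ ∏ i, f (n i) := fun n => by
    have hs : 0 ≤ ∑ i, (n i : ℝ) := by positivity
    have : (1 + ∑ i, (n i : ℝ)) ^ (-t) = ∏ _i : Fin d, (1 + ∑ i, (n i : ℝ)) ^ (-(t / d)) := by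
      rw [Finset.prod_const, Finset.card_univ, Fintype.card_fin, ← Real.rpow_mul_natCast
        (by positivity)]
      congr 1
      field_simp
    rw [this]
    refine Finset.prod_le_prod (fun i _ => by positivity) fun i _ => ?_
    refine Real.rpow_le_rpow_of_nonpos (by positivity) ?_ ?_
    · have := Finset.single_le_sum (f := fun i => (n i : ℝ)) (fun i _ => Nat.cast_nonneg _)
        (Finset.mem_univ i)
      simpa using this
    · have : 0 < t := hd0.trans ht
      exact neg_nonpos.2 (by positivity)
  obtain ⟨M, hM⟩ : ∃ M, u ⊆ Fintype.piFinset fun _ : Fin d => Finset.range M := by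
    refine ⟨u.sup (fun n => Finset.univ.sup n) + 1, fun n hn => ?_⟩
    rw [Fintype.mem_piFinset]
    intro i
    rw [Finset.mem_range, Nat.lt_succ_iff]
    exact (Finset.le_sup (f := n) (Finset.mem_univ i)).trans
      (Finset.le_sup (f := fun n : Fin d → ℕ => Finset.univ.sup n) hn)
  calc ∑ n ∈ u, (1 + ∑ i, (n i : ℝ)) ^ (-t) ≤ ∑ n ∈ u, ∏ i, f (n i) :=
        Finset.sum_le_sum fun n _ => h1 n
    _ ≤ ∑ n ∈ Fintype.piFinset fun _ : Fin d => Finset.range M, ∏ i, f (n i) :=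
        Finset.sum_le_sum_of_subset_of_nonneg hM fun n _ _ =>
          Finset.prod_nonneg fun i _ => hf0 _
    _ = (∑ m ∈ Finset.range M, f m) ^ d := by
        rw [← Finset.prod_univ_sum (fun _ : Fin d => Finset.range M) fun _ m => f m]
        simp
    _ ≤ (∑' m, f m) ^ d := pow_le_pow_left₀ (Finset.sum_nonneg fun m _ => hf0 m)
        (hfs.sum_le_tsum _ fun m _ => hf0 m) d

theorem exists_summable_bound_depth {d : ℕ} (hd : 1 ≤ d) {θ : ℝ} {a : ℂ} {w : Fin d → ℂ}
    (ha : a ∈ halfPlane θ) (hw : ∀ i, w i ∈ halfPlane θ) {t₀ : ℝ} (ht₀ : (d : ℝ) < t₀) (t₁ : ℝ) :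
    ∃ u : (Fin d → ℕ) → ℝ, Summable u ∧ ∀ n t, t₀ ≤ t → t ≤ t₁ →
      depth θ (latticePoint a w n) ^ (-t) ≤ u n := by
  have : Nonempty (Fin d) := ⟨⟨0, hd⟩⟩
  obtain ⟨i₀, hi₀⟩ := Finite.exists_min fun i => depth θ (w i)
  -- The cap at 1 makes c^{-t} increasing in t, so c^{-t₁} serves for every t ≤ t₁.
  set c := min 1 (min (depth θ a) (depth θ (w i₀))) with hc
  have hc0 : 0 < c := lt_min one_pos (lt_min ha (hw i₀))
  have hc1 : c ≤ 1 := min_le_left _ _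
  have hca : c ≤ depth θ a := (min_le_right _ _).trans (min_le_left _ _)
  have hcw : ∀ i, c ≤ depth θ (w i) := fun i =>
    ((min_le_right _ _).trans (min_le_right _ _)).trans (hi₀ i)
  refine ⟨fun n => c ^ (-t₁) * (1 + ∑ i, (n i : ℝ)) ^ (-t₀),
    (summable_one_add_sum_rpow hd ht₀).mul_left _, fun n t h0 h1 => ?_⟩
  have hs : 0 ≤ ∑ i, (n i : ℝ) := by positivity
  have hle : c * (1 + ∑ i, (n i : ℝ)) ≤ depth θ (latticePoint a w n) := by
    rw [depth_latticePoint, mul_add, mul_one, Finset.mul_sum]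
    refine add_le_add hca (Finset.sum_le_sum fun i _ => ?_)
    rw [mul_comm]
    exact mul_le_mul_of_nonneg_left (hcw i) (Nat.cast_nonneg _)
  have ht : 0 ≤ t := ((Nat.cast_nonneg d).trans_lt ht₀).le.trans h0
  refine (Real.rpow_le_rpow_of_nonpos (by positivity) hle (by linarith)).trans ?_
  rw [Real.mul_rpow hc0.le (by positivity)]
  refine mul_le_mul (Real.rpow_le_rpow_of_exponent_ge hc0 hc1 (by linarith))
    (Real.rpow_le_rpow_of_exponent_le (by linarith) (by linarith)) (by positivity) (by positivity)

/-! ### Removable singularities and uniform convergence -/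

theorem finite_poles (d : ℕ) : (poles d).Finite := by
  refine ((Finset.Icc 1 d).finite_toSet.image fun q : ℕ => (q : ℂ)).subset ?_
  rintro α ⟨q, hq, rfl⟩
  exact ⟨q, hq, rfl⟩

theorem isOpen_compl_poles (d : ℕ) : IsOpen (poles d)ᶜ := (finite_poles d).isClosed.isOpen_compl

theorem eventually_notMem_poles (d : ℕ) (α : ℂ) : ∀ᶠ β in 𝓝[≠] α, β ∉ poles d := by
  have h : ((poles d) \ {α})ᶜ ∈ 𝓝 α :=
    ((finite_poles d).subset Set.sdiff_subset).isClosed.isOpen_compl.mem_nhds (by simp)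
  filter_upwards [nhdsWithin_le_nhds h, self_mem_nhdsWithin] with β hβ hne hmem
  exact hβ ⟨hmem, hne⟩

theorem notMem_poles_of_lt {d : ℕ} {α : ℂ} (hα : (d : ℝ) < α.re) : α ∉ poles d := by
  rintro ⟨q, hq, rfl⟩
  rw [natCast_re] at hα
  have := (Finset.mem_Icc.1 hq).2
  exact absurd hα (not_lt.2 (by exact_mod_cast this))

theorem differentiable_branchPow_comp (θ : ℝ) (x : ℂ) {g : ℂ → ℂ} (hg : Differentiable ℂ g) :
    Differentiable ℂ fun α => branchPow θ x (g α) :=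
  (hg.mul_const _).cexp

theorem differentiable_prod_Icc_sub (d : ℕ) :
    Differentiable ℂ fun α : ℂ => ∏ j ∈ Finset.Icc 1 d, ((j : ℂ) - α) :=
  Differentiable.fun_finsetProd fun _ _ => differentiable_id.const_sub _

/-- Clearing denominators in `kernel`. -/
theorem exists_kernel_eq_div {d : ℕ} (hd : 1 ≤ d) {θ : ℝ} (w : Fin d → ℂ) (k : ℤ) {x : ℂ}
    (hx : x ∈ halfPlane θ) :
    ∃ E : ℂ → ℂ, Differentiable ℂ E ∧
      (fun α => kernel θ w k α x) = fun α => E α / ∏ j ∈ Finset.Icc 1 d, ((j : ℂ) - α) := by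
  refine ⟨fun α => ∑ m ∈ Finset.range (k + d).toNat, toddCoeff w m *
    ((∏ i ∈ Finset.range m, ((d : ℂ) - α - i)) * branchPow θ x (d - α - m)), ?_, ?_⟩
  · refine Differentiable.fun_sum fun m _ => Differentiable.const_mul (Differentiable.mul
      (Differentiable.fun_finsetProd fun i _ => ?_) (differentiable_branchPow_comp θ x ?_)) _ <;>
    exact (differentiable_id.const_sub _).sub_const _
  · funext α
    rw [kernel_eq hd w k α hx, Finset.sum_div]
    exact Finset.sum_congr rfl fun m _ => by rw [powDeriv]; ring

theorem differentiableOn_kernel {d : ℕ} (hd : 1 ≤ d) {θ : ℝ} (w : Fin d → ℂ) (k : ℤ) {x : ℂ}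
    (hx : x ∈ halfPlane θ) : DifferentiableOn ℂ (fun α => kernel θ w k α x) (poles d)ᶜ := by
  obtain ⟨E, hE, h⟩ := exists_kernel_eq_div hd w k hx
  rw [h]
  exact hE.differentiableOn.div (differentiable_prod_Icc_sub d).differentiableOn
    fun α hα => prod_Icc_sub_ne_zero hα

theorem differentiableOn_rawTerm {d : ℕ} (hd : 1 ≤ d) {θ : ℝ} {a : ℂ} {w : Fin d → ℂ}
    (ha : a ∈ halfPlane θ) (hw : ∀ i, w i ∈ halfPlane θ) (k : ℤ) (n : Fin d → ℕ) :
    DifferentiableOn ℂ (rawTerm θ a w k n) (poles d)ᶜ := by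
  have hx := latticePoint_mem_halfPlane ha hw n
  refine DifferentiableOn.sub ?_ (DifferentiableOn.fun_sum fun J _ =>
    (differentiableOn_kernel hd w k (add_sum_mem_halfPlane hx hw J)).const_mul _)
  simp_rw [one_div_branchPow]
  exact (differentiable_branchPow_comp θ _ differentiable_id.neg).differentiableOn

variable {d : ℕ} {θ : ℝ} {a : ℂ} {w : Fin d → ℂ} {k : ℤ}

theorem summand_of_notMem {n : Fin d → ℕ} {α : ℂ} (hα : α ∉ poles d) :
    summand θ a w k n α = rawTerm θ a w k n α := if_neg hα

theorem natCast_toNat_add (hk : -(d : ℤ) < k) : (((k + d).toNat : ℕ) : ℝ) = k + d := by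
  have : (((k + d).toNat : ℕ) : ℤ) = k + d := Int.toNat_of_nonneg (by omega)
  exact_mod_cast this

theorem differentiable_summand (hd : 1 ≤ d) (ha : a ∈ halfPlane θ) (hw : ∀ i, w i ∈ halfPlane θ)
    (hk : -(d : ℤ) < k) (n : Fin d → ℕ) : Differentiable ℂ (summand θ a w k n) := by
  have hraw := differentiableOn_rawTerm hd ha hw k n
  intro p
  by_cases hp : p ∈ poles d
  · obtain ⟨C, -, hC⟩ := norm_sub_altSum_kernel_le hd hw (k := k) (N := (k + d).toNat) (by omega)
      rfl (R := ‖p‖ + 1) (by positivity)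
    have hxp : 0 < depth θ (latticePoint a w n) := latticePoint_mem_halfPlane ha hw n
    obtain ⟨r, hr0, hr1, hr⟩ : ∃ r, 0 < r ∧ r ≤ 1 ∧
        ∀ β ∈ Metric.closedBall p r, β ≠ p → β ∉ poles d := by
      have := eventually_notMem_poles d p
      rw [eventually_nhdsWithin_iff, Metric.nhds_basis_closedBall.eventually_iff] at this
      obtain ⟨r, hr0, hr⟩ := this
      exact ⟨min r 1, lt_min hr0 one_pos, min_le_right _ _, fun β hβ =>
        hr (Metric.closedBall_subset_closedBall (min_le_left _ _) hβ)⟩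
    have hdiff : DifferentiableOn ℂ (rawTerm θ a w k n) (Metric.closedBall p r \ {p}) :=
      hraw.mono fun β hβ => hr β hβ.1 hβ.2
    have hcont : ContinuousOn (fun β : ℂ => C * depth θ (latticePoint a w n) ^
        (-(β.re + (k + d).toNat))) (Metric.closedBall p r) :=
      Continuous.continuousOn (by
        refine continuous_const.mul (continuous_const.rpow (by fun_prop) fun _ => Or.inl hxp.ne'))
    obtain ⟨B, hB⟩ := (isCompact_closedBall p r).bddAbove_image hcont
    -- The remainder estimate holds off the poles with C independent of α, so the summand is bounded
    -- near p. Riemann's theorem then fills in the limit, which is the value `summand` takes at p.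
    have hbdd : BddAbove (norm ∘ rawTerm θ a w k n '' (Metric.closedBall p r \ {p})) := by
      refine ⟨B, ?_⟩
      rintro _ ⟨β, ⟨hβ, hne⟩, rfl⟩
      have hβp : ‖β - p‖ ≤ 1 := by
        rw [← dist_eq_norm]
        exact (Metric.mem_closedBall.1 hβ).trans hr1
      refine (hC β (hr β hβ hne) ?_ ?_ _ hxp).trans (hB ⟨β, hβ, rfl⟩)
      · have := norm_add_le p (β - p)
        rw [add_sub_cancel] at this
        linarith
      · obtain ⟨q, hq, rfl⟩ := hp
        have h1 : (1 : ℝ) ≤ q := by exact_mod_cast (Finset.mem_Icc.1 hq).1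
        have h2 := (abs_le.1 ((abs_re_le_norm _).trans hβp)).1
        have h3 : (0 : ℝ) ≤ (k + d).toNat := Nat.cast_nonneg _
        rw [sub_re, natCast_re] at h2
        linarith
    have hball := Metric.closedBall_mem_nhds p hr0
    refine ((differentiableOn_update_limUnder_of_bddAbove hball hdiff hbdd).differentiableAt
      hball).congr_of_eventuallyEq ?_
    filter_upwards [hball] with β hβ
    rcases eq_or_ne β p with rfl | hne
    · rw [Function.update_self, summand, if_pos hp]
    · rw [Function.update_of_ne hne, summand_of_notMem (hr β hβ hne)]
  · have hmem := (isOpen_compl_poles d).mem_nhds hp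
    refine (hraw.differentiableAt hmem).congr_of_eventuallyEq ?_
    filter_upwards [hmem] with β hβ using summand_of_notMem hβ

theorem exists_summable_bound_summand (hd : 1 ≤ d) (ha : a ∈ halfPlane θ)
    (hw : ∀ i, w i ∈ halfPlane θ) (hk : -(d : ℤ) < k) {σ : ℝ} (hσ : -(k : ℝ) < σ) (R : ℝ) :
    ∃ u : (Fin d → ℕ) → ℝ, Summable u ∧ ∀ n α, σ < α.re → ‖α‖ < R →
      ‖summand θ a w k n α‖ ≤ u n := by
  obtain ⟨C, hC0, hC⟩ := norm_sub_altSum_kernel_le hd hw (k := k) (N := (k + d).toNat) (by omega)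
    rfl (R := |R|) (abs_nonneg _)
  have hN := natCast_toNat_add hk
  -- Since N = k + d, the condition σ > -k says exactly that the decay exponent σ + N exceeds d.
  obtain ⟨u, hu, hub⟩ := exists_summable_bound_depth hd ha hw
    (t₀ := σ + (k + d).toNat) (by rw [hN]; linarith) (R + (k + d).toNat)
  have hNk : -((k + d).toNat : ℝ) < σ := by
    rw [hN]
    have : (0 : ℝ) ≤ d := Nat.cast_nonneg _
    linarith
  refine ⟨fun n => C * u n, hu.mul_left _, fun n α h1 h2 => ?_⟩
  have hoff : ∀ β : ℂ, σ < β.re → ‖β‖ < R → β ∉ poles d → ‖summand θ a w k n β‖ ≤ C * u n := by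
    intro β h1 h2 hβ
    rw [summand_of_notMem hβ]
    refine (hC β hβ (h2.le.trans (le_abs_self R)) (by linarith) _
      (latticePoint_mem_halfPlane ha hw n)).trans (mul_le_mul_of_nonneg_left (hub n _ ?_ ?_) hC0)
    · linarith
    · linarith [re_le_norm β]
  -- Continuity carries the bound from nearby points off {1, …, d} to α itself.
  have hev : ∀ᶠ β in 𝓝[≠] α, ‖summand θ a w k n β‖ ≤ C * u n := by
    have e1 : ∀ᶠ β : ℂ in 𝓝[≠] α, σ < β.re :=
      nhdsWithin_le_nhds (continuous_re.continuousAt.eventually_const_lt h1)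
    have e2 : ∀ᶠ β : ℂ in 𝓝[≠] α, ‖β‖ < R :=
      nhdsWithin_le_nhds (continuous_norm.continuousAt.eventually_lt_const h2)
    filter_upwards [e1, e2, eventually_notMem_poles d α] with β using hoff β
  exact le_of_tendsto ((differentiable_summand hd ha hw hk n α).continuousAt.norm.tendsto.mono_left
    nhdsWithin_le_nhds) hev

theorem isOpen_re_gt (σ : ℝ) : IsOpen {α : ℂ | σ < α.re} := isOpen_lt continuous_const continuous_re

theorem differentiableOn_tsum_summand (hd : 1 ≤ d) (ha : a ∈ halfPlane θ)
    (hw : ∀ i, w i ∈ halfPlane θ) (hk : -(d : ℤ) < k) :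
    DifferentiableOn ℂ (fun α => ∑' n, summand θ a w k n α) {α : ℂ | -(k : ℝ) < α.re} := by
  intro α hα
  obtain ⟨σ, h1, h2⟩ := exists_between (Set.mem_ofPred.1 hα)
  obtain ⟨u, hu, hub⟩ := exists_summable_bound_summand hd ha hw hk h1 (‖α‖ + 1)
  have hU : IsOpen ({β : ℂ | σ < β.re} ∩ {β : ℂ | ‖β‖ < ‖α‖ + 1}) :=
    (isOpen_re_gt σ).inter (isOpen_lt continuous_norm continuous_const)
  exact ((differentiableOn_tsum_of_summable_norm hu
    (fun n => (differentiable_summand hd ha hw hk n).differentiableOn) hU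
    fun n β hβ => hub n β hβ.1 hβ.2).differentiableAt
      (hU.mem_nhds ⟨h2, by simp⟩)).differentiableWithinAt

theorem hasSumUniformlyOn_summand (hd : 1 ≤ d) (ha : a ∈ halfPlane θ)
    (hw : ∀ i, w i ∈ halfPlane θ) (hk : -(d : ℤ) < k) {K : Set ℂ} (hK : IsCompact K)
    (hKk : K ⊆ {α : ℂ | -(k : ℝ) < α.re}) :
    HasSumUniformlyOn (summand θ a w k) (fun α => ∑' n, summand θ a w k n α) K := by
  obtain ⟨σ, h1, h2⟩ : ∃ σ, -(k : ℝ) < σ ∧ ∀ α ∈ K, σ < α.re := by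
    rcases K.eq_empty_or_nonempty with rfl | hne
    · exact ⟨-k + 1, by linarith, by simp⟩
    · obtain ⟨α₀, hα₀, hmin⟩ := hK.exists_isMinOn hne continuous_re.continuousOn
      obtain ⟨σ, h1, h2⟩ := exists_between (Set.mem_ofPred.1 (hKk hα₀))
      exact ⟨σ, h1, fun α hα => h2.trans_le (hmin hα)⟩
  obtain ⟨R, hR⟩ := hK.isBounded.exists_norm_le
  obtain ⟨u, hu, hub⟩ := exists_summable_bound_summand hd ha hw hk h1 (R + 1)
  exact HasSumUniformlyOn.of_norm_le_summable hu fun n α hα =>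
    hub n α (h2 α hα) (by linarith [hR α hα])

end Barnes

end

/-! ### The representation for Re α > d -/

noncomputable section

namespace Barnes

variable {d : ℕ} {θ : ℝ} {a : ℂ} {w : Fin d → ℂ} {k : ℤ}

theorem neg_lt_of_lt_re (hk : -(d : ℤ) < k) {α : ℂ} (hα : (d : ℝ) < α.re) : -(k : ℝ) < α.re := by
  have : -(d : ℝ) < k := by exact_mod_cast hk
  linarith

theorem summable_branchPow_latticePoint (hd : 1 ≤ d) (ha : a ∈ halfPlane θ)
    (hw : ∀ i, w i ∈ halfPlane θ) {α : ℂ} (hα : (d : ℝ) < α.re) :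
    Summable fun n : Fin d → ℕ => branchPow θ (latticePoint a w n) (-α) := by
  obtain ⟨u, hu, hub⟩ := exists_summable_bound_depth hd ha hw hα α.re
  refine Summable.of_norm_bounded (hu.mul_left (Real.exp (‖-α‖ * (|θ| + Real.pi)))) fun n => ?_
  have hd0 : (0 : ℝ) ≤ d := Nat.cast_nonneg _
  refine (norm_branchPow_le (latticePoint_mem_halfPlane ha hw n)
    (by rw [neg_re]; linarith)).trans ?_
  exact mul_le_mul_of_nonneg_left (hub n _ le_rfl le_rfl) (Real.exp_pos _).le

theorem tendsto_branchPow_zero (ha : a ∈ halfPlane θ) {v : ℂ} (hv : v ∈ halfPlane θ) {s : ℂ}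
    (hs : s.re < 0) : Tendsto (fun M : ℕ => branchPow θ (a + M * v) s) atTop (𝓝 0) := by
  have hv' : 0 < depth θ v := hv
  have ha' : 0 < depth θ a := ha
  have hdep : ∀ M : ℕ, depth θ (a + M * v) = depth θ a + M * depth θ v := fun M => by
    rw [depth_add, ← ofReal_natCast, depth_real_mul]
  have h1 : Tendsto (fun M : ℕ => depth θ (a + M * v)) atTop atTop := by
    simp_rw [hdep]
    exact tendsto_atTop_add_const_left _ _ (tendsto_natCast_atTop_atTop.atTop_mul_const hv')
  have h2 := ((tendsto_rpow_neg_atTop (neg_pos.2 hs)).comp h1).const_mul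
    (Real.exp (‖s‖ * (|θ| + Real.pi)))
  rw [mul_zero] at h2
  refine squeeze_zero_norm (fun M => ?_) h2
  have hmem : a + M * v ∈ halfPlane θ := by
    change 0 < depth θ _
    rw [hdep]
    positivity
  simpa using norm_branchPow_le hmem hs.le

theorem tendsto_kernel_zero (hd : 1 ≤ d) (ha : a ∈ halfPlane θ) {v : ℂ} (hv : v ∈ halfPlane θ)
    {α : ℂ} (hα : (d : ℝ) < α.re) :
    Tendsto (fun M : ℕ => kernel θ w k α (a + M * v)) atTop (𝓝 0) := by
  have hmem : ∀ M : ℕ, a + M * v ∈ halfPlane θ := fun M => by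
    have hv' : 0 < depth θ v := hv
    have ha' : 0 < depth θ a := ha
    change 0 < depth θ _
    rw [depth_add, ← ofReal_natCast, depth_real_mul]
    positivity
  have h : ∀ M : ℕ, _ = _ := fun M => kernel_eq hd w k α (hmem M)
  simp_rw [h]
  rw [← Finset.sum_const_zero (s := Finset.range (k + d).toNat)]
  refine tendsto_finsetSum _ fun m _ => ?_
  have hre : ((d : ℂ) - α - m).re < 0 := by
    have : (0 : ℝ) ≤ m := Nat.cast_nonneg _
    simp only [sub_re, natCast_re]
    linarith
  simpa [powDeriv] using
    ((tendsto_branchPow_zero ha hv hre).const_mul _).const_mul (toddCoeff w m)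

theorem tendsto_sum_box_altSum_kernel (hd : 1 ≤ d) (ha : a ∈ halfPlane θ)
    (hw : ∀ i, w i ∈ halfPlane θ) {α : ℂ} (hα : (d : ℝ) < α.re) :
    Tendsto (fun M : ℕ => ∑ n ∈ Fintype.piFinset fun _ : Fin d => Finset.range M,
      altSum w (kernel θ w k α) (latticePoint a w n)) atTop (𝓝 (finiteTerm θ a w k α)) := by
  simp_rw [sum_altSum_box, altSum, ← Finset.mul_sum]
  -- Only J = ∅ keeps its argument at a; for nonempty J the argument a + M ∑_{i∈J} wᵢ goes to
  -- infinity and the kernel tends to 0.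
  have h : finiteTerm θ a w k α = ∑ J : Finset (Fin d), if J = ∅ then finiteTerm θ a w k α else 0 := by
    simp
  rw [h]
  refine tendsto_finsetSum _ fun J _ => ?_
  split_ifs with hJ
  · subst hJ
    simp [finiteTerm]
  · have hv : ∑ i ∈ J, w i ∈ halfPlane θ := by
      change 0 < depth θ _
      rw [depth_sum]
      exact Finset.sum_pos (fun i _ => hw i) (Finset.nonempty_iff_ne_empty.2 hJ)
    simpa using (tendsto_kernel_zero (w := w) (k := k) hd ha hv hα).const_mul ((-1) ^ (d - J.card))

theorem tendsto_box_atTop (d : ℕ) :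
    Tendsto (fun M : ℕ => Fintype.piFinset fun _ : Fin d => Finset.range M) atTop atTop := by
  refine tendsto_atTop_finset_of_monotone (fun M M' h => Fintype.piFinset_subset _ _ fun _ =>
    Finset.range_subset_range.2 h) fun n => ⟨Finset.univ.sup n + 1, ?_⟩
  rw [Fintype.mem_piFinset]
  intro i
  rw [Finset.mem_range, Nat.lt_succ_iff]
  exact Finset.le_sup (f := n) (Finset.mem_univ i)

theorem summable_summand (hd : 1 ≤ d) (ha : a ∈ halfPlane θ) (hw : ∀ i, w i ∈ halfPlane θ)
    (hk : -(d : ℤ) < k) {α : ℂ} (hα : -(k : ℝ) < α.re) :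
    Summable fun n => summand θ a w k n α :=
  ((hasSumUniformlyOn_summand hd ha hw hk (isCompact_singleton (x := α))
    (Set.singleton_subset_iff.2 hα)).hasSum rfl).summable

/-- The representation of the Barnes series in its half-plane of convergence. -/
theorem hasSum_branchPow_latticePoint (hd : 1 ≤ d) (ha : a ∈ halfPlane θ)
    (hw : ∀ i, w i ∈ halfPlane θ) (hk : -(d : ℤ) < k) {α : ℂ} (hα : (d : ℝ) < α.re) :
    HasSum (fun n : Fin d → ℕ => branchPow θ (latticePoint a w n) (-α))
      (∑' n, summand θ a w k n α + finiteTerm θ a w k α) := by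
  have h1 := (summable_branchPow_latticePoint hd ha hw hα).hasSum
  have h2 := (summable_summand hd ha hw hk (neg_lt_of_lt_re hk hα)).hasSum
  -- The G-terms are differences of two summable families, so their sum may be computed along boxes,
  -- where it telescopes.
  have h3 := (h1.sub h2).comp (tendsto_box_atTop d)
  have h4 : ∀ n, branchPow θ (latticePoint a w n) (-α) - summand θ a w k n α
      = altSum w (kernel θ w k α) (latticePoint a w n) := fun n => by
    rw [summand_of_notMem (notMem_poles_of_lt hα), rawTerm, one_div_branchPow]
    ring
  simp only [Function.comp_def, h4] at h3
  rw [← tendsto_nhds_unique h3 (tendsto_sum_box_altSum_kernel hd ha hw hα)]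
  simpa using h1

/-! ### Gluing, uniqueness and pole orders -/

/-- The sum of the series and of the term outside it. -/
def seriesZeta (θ : ℝ) (a : ℂ) (w : Fin d → ℂ) (k : ℤ) (α : ℂ) : ℂ :=
  ∑' n, summand θ a w k n α + finiteTerm θ a w k α

theorem exists_finiteTerm_eq_div (hd : 1 ≤ d) (ha : a ∈ halfPlane θ) (w : Fin d → ℂ) (k : ℤ) :
    ∃ E : ℂ → ℂ, Differentiable ℂ E ∧
      finiteTerm θ a w k = fun α => E α / ∏ j ∈ Finset.Icc 1 d, ((j : ℂ) - α) := by
  obtain ⟨E, hE, h⟩ := exists_kernel_eq_div hd w k ha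
  refine ⟨fun α => (-1) ^ d * E α, hE.const_mul _, ?_⟩
  funext α
  rw [finiteTerm, congrFun h α, mul_div_assoc]

theorem differentiableOn_seriesZeta (hd : 1 ≤ d) (ha : a ∈ halfPlane θ)
    (hw : ∀ i, w i ∈ halfPlane θ) (hk : -(d : ℤ) < k) :
    DifferentiableOn ℂ (seriesZeta θ a w k) ({α : ℂ | -(k : ℝ) < α.re} ∩ (poles d)ᶜ) :=
  ((differentiableOn_tsum_summand hd ha hw hk).mono Set.inter_subset_left).add
    (((differentiableOn_kernel hd w k ha).const_mul _).mono Set.inter_subset_right)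

/-- Clearing denominators in `seriesZeta`. -/
theorem exists_seriesZeta_mul_eq (hd : 1 ≤ d) (ha : a ∈ halfPlane θ)
    (hw : ∀ i, w i ∈ halfPlane θ) (hk : -(d : ℤ) < k) :
    ∃ h : ℂ → ℂ, DifferentiableOn ℂ h {α : ℂ | -(k : ℝ) < α.re} ∧ ∀ α ∉ poles d,
      seriesZeta θ a w k α * ∏ j ∈ Finset.Icc 1 d, ((j : ℂ) - α) = h α := by
  obtain ⟨E, hE, h⟩ := exists_finiteTerm_eq_div hd ha w k
  refine ⟨_, ((differentiableOn_tsum_summand hd ha hw hk).mul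
    (differentiable_prod_Icc_sub d).differentiableOn).add hE.differentiableOn, fun α hα => ?_⟩
  rw [seriesZeta, h, add_mul, div_mul_cancel₀ _ (prod_Icc_sub_ne_zero hα)]
  rfl

/-- Both sides equal the Barnes series for Re α > d. Multiplying by ∏ (j - α) lets the identity
theorem run on the whole convex half-plane, with no punctures. -/
theorem seriesZeta_eq_of_le (hd : 1 ≤ d) (ha : a ∈ halfPlane θ)
    (hw : ∀ i, w i ∈ halfPlane θ) (hk : -(d : ℤ) < k) {k' : ℤ} (hkk' : k ≤ k') {α : ℂ}
    (hα : -(k : ℝ) < α.re) (hαp : α ∉ poles d) :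
    seriesZeta θ a w k α = seriesZeta θ a w k' α := by
  have hk' : -(d : ℤ) < k' := hk.trans_le hkk'
  have hcast : -(k' : ℝ) ≤ -(k : ℝ) := neg_le_neg (by exact_mod_cast hkk')
  obtain ⟨h, hh, heq⟩ := exists_seriesZeta_mul_eq hd ha hw hk
  obtain ⟨h', hh', heq'⟩ := exists_seriesZeta_mul_eq hd ha hw hk'
  have hsub : {α : ℂ | -(k : ℝ) < α.re} ⊆ {α : ℂ | -(k' : ℝ) < α.re} :=
    fun β hβ => hcast.trans_lt hβ
  have hd1 : (d : ℝ) < ((d : ℂ) + 1).re := by simp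
  have hE : Set.EqOn h h' {α : ℂ | -(k : ℝ) < α.re} := by
    refine (hh.analyticOnNhd (isOpen_re_gt _)).eqOn_of_preconnected_of_eventuallyEq
      ((hh'.mono hsub).analyticOnNhd (isOpen_re_gt _))
      (convex_halfSpace_re_gt _).isPreconnected (neg_lt_of_lt_re hk hd1) ?_
    filter_upwards [(isOpen_re_gt (d : ℝ)).mem_nhds hd1] with β hβ
    rw [← heq β (notMem_poles_of_lt hβ), ← heq' β (notMem_poles_of_lt hβ), seriesZeta, seriesZeta,
      (hasSum_branchPow_latticePoint hd ha hw hk hβ).unique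
        (hasSum_branchPow_latticePoint hd ha hw hk' hβ)]
  have := hE hα
  rw [← heq α hαp, ← heq' α hαp] at this
  exact mul_right_cancel₀ (prod_Icc_sub_ne_zero hαp) this

theorem seriesZeta_eq (hd : 1 ≤ d) (ha : a ∈ halfPlane θ)
    (hw : ∀ i, w i ∈ halfPlane θ) (hk : -(d : ℤ) < k) {k' : ℤ} (hk' : -(d : ℤ) < k') {α : ℂ}
    (hα : -(k : ℝ) < α.re) (hα' : -(k' : ℝ) < α.re) (hαp : α ∉ poles d) :
    seriesZeta θ a w k α = seriesZeta θ a w k' α := by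
  rcases le_total k k' with h | h
  · exact seriesZeta_eq_of_le hd ha hw hk h hα hαp
  · exact (seriesZeta_eq_of_le hd ha hw hk' h hα' hαp).symm

/-- The Barnes zeta function glued from the functions `seriesZeta` on increasing half-planes. -/
def gluedZeta (θ : ℝ) (a : ℂ) (w : Fin d → ℂ) (α : ℂ) : ℂ :=
  seriesZeta θ a w (⌊|α.re|⌋ + 1) α

theorem gluedZeta_eq (hd : 1 ≤ d) (ha : a ∈ halfPlane θ)
    (hw : ∀ i, w i ∈ halfPlane θ) (hk : -(d : ℤ) < k) {α : ℂ}
    (hα : -(k : ℝ) < α.re) (hαp : α ∉ poles d) :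
    gluedZeta θ a w α = seriesZeta θ a w k α := by
  -- The index ⌊|Re α|⌋ + 1 exceeds both -d and -Re α, so it is admissible at α.
  have h0 : 0 ≤ ⌊|α.re|⌋ := Int.floor_nonneg.2 (abs_nonneg _)
  refine seriesZeta_eq hd ha hw (by omega) hk ?_ hα hαp
  have h1 := Int.lt_floor_add_one |α.re|
  have h2 := neg_abs_le α.re
  push_cast
  linarith

theorem isZetaContinuation_gluedZeta (hd : 1 ≤ d) (ha : a ∈ halfPlane θ)
    (hw : ∀ i, w i ∈ halfPlane θ) : IsZetaContinuation θ a w (gluedZeta θ a w) := by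
  constructor
  · intro α hα
    -- The index in `gluedZeta` jumps with α, but one fixed k is valid on a whole neighbourhood.
    obtain ⟨k, hk⟩ := exists_nat_gt (-α.re)
    have hkd : -(d : ℤ) < (k : ℤ) := by omega
    have hU := (isOpen_re_gt (-((k : ℤ) : ℝ))).inter (isOpen_compl_poles d)
    have hmem : α ∈ {α : ℂ | -((k : ℤ) : ℝ) < α.re} ∩ (poles d)ᶜ :=
      ⟨by simp only [Set.mem_ofPred_eq, Int.cast_natCast]; linarith, hα⟩
    refine (((differentiableOn_seriesZeta hd ha hw hkd).differentiableAt
      (hU.mem_nhds hmem)).congr_of_eventuallyEq ?_).differentiableWithinAt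
    filter_upwards [hU.mem_nhds hmem] with β hβ using gluedZeta_eq hd ha hw hkd hβ.1 hβ.2
  · intro α hα
    have h0 : -(d : ℤ) < 0 := by omega
    rw [gluedZeta_eq hd ha hw h0 (neg_lt_of_lt_re h0 hα) (notMem_poles_of_lt hα)]
    exact hasSum_branchPow_latticePoint hd ha hw h0 hα

/-- Removing finitely many points leaves the plane connected, so the identity theorem applies. -/
theorem IsZetaContinuation.eqOn {Z Z' : ℂ → ℂ} (h : IsZetaContinuation θ a w Z)
    (h' : IsZetaContinuation θ a w Z') : Set.EqOn Z Z' (poles d)ᶜ := by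
  have hd1 : (d : ℝ) < ((d : ℂ) + 1).re := by simp
  have hrank : 1 < Module.rank ℝ ℂ := by
    rw [Complex.rank_real_complex]
    exact_mod_cast one_lt_two
  refine (h.1.analyticOnNhd (isOpen_compl_poles d)).eqOn_of_preconnected_of_eventuallyEq
    (h'.1.analyticOnNhd (isOpen_compl_poles d))
    ((finite_poles d).countable.isPathConnected_compl_of_one_lt_rank
      hrank).isConnected.isPreconnected (notMem_poles_of_lt hd1) ?_
  filter_upwards [(isOpen_re_gt (d : ℝ)).mem_nhds hd1] with β hβ
  exact (h.2 β hβ).unique (h'.2 β hβ)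

theorem isZetaContinuation_zeta (hd : 1 ≤ d) (ha : a ∈ halfPlane θ)
    (hw : ∀ i, w i ∈ halfPlane θ) : IsZetaContinuation θ a w (zeta θ a w) := by
  have h : ∃ Z, IsZetaContinuation θ a w Z := ⟨_, isZetaContinuation_gluedZeta hd ha hw⟩
  rw [zeta, dif_pos h]
  exact h.choose_spec

theorem zeta_eq (hd : 1 ≤ d) (ha : a ∈ halfPlane θ)
    (hw : ∀ i, w i ∈ halfPlane θ) (hk : -(d : ℤ) < k) {α : ℂ}
    (hα : -(k : ℝ) < α.re) (hαp : α ∉ poles d) :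
    zeta θ a w α = ∑' n, summand θ a w k n α + finiteTerm θ a w k α :=
  ((isZetaContinuation_zeta hd ha hw).eqOn (isZetaContinuation_gluedZeta hd ha hw) hαp).trans
    (gluedZeta_eq hd ha hw hk hα hαp)

/-- Adding an analytic function does not change the pole order. -/
theorem min_meromorphicOrderAt_add_analytic {S P : ℂ → ℂ} {α : ℂ} (hS : AnalyticAt ℂ S α)
    (hP : MeromorphicAt P α) :
    min (meromorphicOrderAt (S + P) α) 0 = min (meromorphicOrderAt P α) 0 := by
  have hS0 := hS.meromorphicOrderAt_nonneg
  rcases lt_or_ge (meromorphicOrderAt P α) 0 with h | h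
  · rw [meromorphicOrderAt_add_eq_right_of_lt hS.meromorphicAt (h.trans_le hS0)]
  · rw [min_eq_right h,
      min_eq_right ((le_min hS0 h).trans (meromorphicOrderAt_add hS.meromorphicAt hP))]

theorem meromorphicAt_finiteTerm (hd : 1 ≤ d) (ha : a ∈ halfPlane θ) (w : Fin d → ℂ) (k : ℤ)
    (α : ℂ) : MeromorphicAt (finiteTerm θ a w k) α := by
  obtain ⟨E, hE, h⟩ := exists_finiteTerm_eq_div hd ha w k
  rw [h]
  exact (hE.analyticAt α).meromorphicAt.div
    ((differentiable_prod_Icc_sub d).analyticAt α).meromorphicAt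

end Barnes

end

theorem mainTheorem10 (d : ℕ) (hd : 1 ≤ d) (θ : ℝ) (a : ℂ) (w : Fin d → ℂ)
    (ha : a ∈ Barnes.halfPlane θ) (hw : ∀ i, w i ∈ Barnes.halfPlane θ)
    (k : ℤ) (hk : -(d : ℤ) < k) :
    -- every summand (continued to `α = 1, …, d`) is entire in `α`
    (∀ n : Fin d → ℕ, Differentiable ℂ (Barnes.summand θ a w k n)) ∧
    -- the series converges uniformly on compact subsets of the half-plane `Re α > -k`
    (∀ K : Set ℂ, IsCompact K → K ⊆ {α : ℂ | -(k : ℝ) < α.re} →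
      HasSumUniformlyOn (Barnes.summand θ a w k) (fun α => ∑' n, Barnes.summand θ a w k n α) K) ∧
    -- hence its sum is analytic there
    AnalyticOnNhd ℂ (fun α => ∑' n, Barnes.summand θ a w k n α) {α : ℂ | -(k : ℝ) < α.re} ∧
    -- the pole structure of `ζ_B` in this half-plane is that of the term outside the series
    Barnes.IsZetaContinuation θ a w (Barnes.zeta θ a w) ∧
    (∀ α : ℂ, -(k : ℝ) < α.re → α ∉ Barnes.poles d →
      Barnes.zeta θ a w α = (∑' n, Barnes.summand θ a w k n α) + Barnes.finiteTerm θ a w k α) ∧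
    (∀ α : ℂ, -(k : ℝ) < α.re →
      MeromorphicAt (Barnes.zeta θ a w) α ∧ MeromorphicAt (Barnes.finiteTerm θ a w k) α ∧
      min (meromorphicOrderAt (Barnes.zeta θ a w) α) 0
        = min (meromorphicOrderAt (Barnes.finiteTerm θ a w k) α) 0) := by
  have hS := (Barnes.differentiableOn_tsum_summand hd ha hw hk).analyticOnNhd
    (Barnes.isOpen_re_gt _)
  refine ⟨Barnes.differentiable_summand hd ha hw hk,
    fun K hK hKk => Barnes.hasSumUniformlyOn_summand hd ha hw hk hK hKk, hS,
    Barnes.isZetaContinuation_zeta hd ha hw,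
    fun α hα hαp => Barnes.zeta_eq hd ha hw hk hα hαp, fun α hα => ?_⟩
  have hP := Barnes.meromorphicAt_finiteTerm hd ha w k α
  -- A punctured neighbourhood suffices: meromorphic orders ignore the value at the point itself,
  -- which is not controlled when α is one of 1, …, d.
  have heq : Barnes.zeta θ a w =ᶠ[𝓝[≠] α]
      (fun α => ∑' n, Barnes.summand θ a w k n α) + Barnes.finiteTerm θ a w k := by
    filter_upwards [nhdsWithin_le_nhds ((Barnes.isOpen_re_gt _).mem_nhds hα),
      Barnes.eventually_notMem_poles d α] with β hβ hβp using
      Barnes.zeta_eq hd ha hw hk hβ hβp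
  refine ⟨((hS α hα).meromorphicAt.add hP).congr heq.symm, hP, ?_⟩
  rw [meromorphicOrderAt_congr heq, Barnes.min_meromorphicOrderAt_add_analytic (hS α hα) hP]
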